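/- All metric spaces $X$ below have bounded geometry: for every $R>0$ there is $N$ with $|B(x;R)|\le N$ for all $x\in X$, where $B(x;R)=\{y: d(x,y)\le R\}$. Write $N_R(E)=\{y: d(y,E)\le R\}$ and $\partial_RE=N_R(E)\setminus E$. A probability measure $\mu$ on $X$ is a function $\mu:X\to[0,1]$ with $\sum_x\mu(x)=1$, and $\mu(E)=\sum_{x\in E}\mu(x)$; $\mathrm{Prob}(X)\subseteq\ell^1(X)$ is the set of these. Consider the following properties of $X$. - Property $A$: for all $R,\epsilon>0$ there are $S>0$ and $\xi:X\to\mathrm{Prob}(X)$, $x\mapsto\xi_x$, such that $\|\xi_x-\xi_y\|_1<\epsilon$ whenever $d(x,y)\le R$, and $\xi_x$ is supported in $B(x;S)$ for all $x$. - $ULA_\mu$: for all $R,\epsilon>0$ there is $S>0$ such that for every probability measure $\mu$ on $X$ there is a finite set $E\subseteq X$ with $\mathrm{diam}(E)\le S$ and $\mu(\partial_RE)<\epsilon\,\mu(E)$. - $ULA_\mu'$: for all $R,\epsilon>0$ there is $S>0$ such that for every probability measure $\mu$ on $X$ there is $\phi\in\ell^1(X)$ with $\mathrm{diam}(\mathrm{supp}\,\phi)\le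 S$ and $$\sum_{x\in\mathrm{supp}\,\mu}\mu(x)\sum_{y\in\mathrm{supp}\,\mu,\ d(x,y)\le R}|\phi(x)-\phi(y)|<\epsilon\sum_{x\in\mathrm{supp}\,\mu}\mu(x)|\phi(x)|.$$ - $MSP$ (metric sparsification): there is $c>0$ such that for all $R>0$ there is $S>0$ such that for every probability measure $\mu$ on $X$ there is a subset $\Omega=\bigsqcup_i\Omega_i$ of $X$ with $\mu(\Omega)\ge c$, $\mathrm{diam}(\Omega_i)\le S$ for all $i$, and $d(\Omega_i,\Omega_j)>R$ for all $i\ne j$. - $ONL$ (operator norm localisation): there is $c>0$ such that for all $R>0$ there is $S>0$ such that for every probability measure $\mu$ on $X$, every nonzero separable complex Hilbert space $H$ and every bounded operator $T=(T_{x,y})$ on $\ell^2(X,\mu,H)$ with $T_{x,y}=0$ whenever $d(x,y)>R$, there is a unit vector $\phi\in\ell^2(X,\mu,H)$ with $\mathrm{diam}(\mathrm{supp}\,\phi)\le S$ and $\|T\phi\|\ge c\|T\|$. Here $\ell^2(X,\mu,H)$ is the space of functions $\phi:X\to H$ with $\|\phi\|^2=\sum_x\mu(x)\|\phi(x)\|^2<\infty$,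 modulo functions of norm zero. Then for every bounded geometry metric space $X$: (i) $A\Rightarrow ULA_\mu$; (ii) $ULA_\mu\Leftrightarrow ULA_\mu'$; (iii) $ULA_\mu\Leftrightarrow MSP$; (iv) $MSP\Rightarrow ONL$; hence (v) $A\Rightarrow ONL$. In particular, (vi) every amenable (countable, discrete) group $G$, equipped with any proper left-invariant metric (i.e. one whose balls are finite), has $MSP$ and $ONL$. Amenable means the Følner condition: for every finite $K\subseteq G$ and $\epsilon>0$ there is a finite nonempty $F\subseteq G$ with $|kF\,\triangle\,F|\le\epsilon|F|$ for all $k\in K$. -/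

import Mathlib

open MeasureTheory
open scoped ENNReal Pointwise symmDiff

universe u v w

noncomputable section

namespace CoarseGeometry

/-- Bounded geometry: closed balls of radius `R` have uniformly bounded cardinality. -/
def BoundedGeometry (X : Type u) [MetricSpace X] : Prop :=
  ∀ R : ℝ, 0 < R → ∃ N : ℕ, ∀ x : X, (Metric.closedBall x R).encard ≤ N

/-- The statement `diam E ≤ S`, with the diameter taken in `[0, ∞]`. -/
def DiamLE {X : Type u} [MetricSpace X] (E : Set X) (S : ℝ) : Prop :=
  Metric.ediam E ≤ ENNReal.ofReal S

/-- The distance between two sets, `inf d(x, y)`, in `[0, ∞]`. -/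
def setDist {X : Type u} [MetricSpace X] (A B : Set X) : ℝ≥0∞ :=
  ⨅ x ∈ A, ⨅ y ∈ B, edist x y

/-- The `R`-boundary `∂_R E = N_R(E) \ E`, where `N_R(E) = {y | d(y, E) ≤ R}`. -/
def boundary {X : Type u} [MetricSpace X] (R : ℝ) (E : Set X) : Set X :=
  Metric.cthickening R E \ E

/-- The measure `μ(E)` of a subset `E`, for a probability measure `μ` on the discrete set `X`. -/
def mass {X : Type u} (μ : PMF X) (E : Set X) : ℝ :=
  (μ.toOuterMeasure E).toReal

/-- Property A. Elements of `Prob(X)` are probability mass functions, compared in `ℓ¹`-norm. -/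
def PropertyA (X : Type u) [MetricSpace X] : Prop :=
  ∀ R : ℝ, 0 < R → ∀ ε : ℝ, 0 < ε → ∃ S : ℝ, 0 < S ∧ ∃ ξ : X → PMF X,
    (∀ x y : X, dist x y ≤ R → ∑' z, |(ξ x z).toReal - (ξ y z).toReal| < ε) ∧
    (∀ x : X, (ξ x).support ⊆ Metric.closedBall x S)

/-- `ULA_μ`, in its formulation with sets. -/
def ULAmu (X : Type u) [MetricSpace X] : Prop :=
  ∀ R : ℝ, 0 < R → ∀ ε : ℝ, 0 < ε → ∃ S : ℝ, 0 < S ∧ ∀ μ : PMF X, ∃ E : Set X,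
    E.Finite ∧ DiamLE E S ∧ mass μ (boundary R E) < ε * mass μ E

/-- `ULA_μ`, in its formulation with functions. -/
def ULAmuFun (X : Type u) [MetricSpace X] : Prop :=
  ∀ R : ℝ, 0 < R → ∀ ε : ℝ, 0 < ε → ∃ S : ℝ, 0 < S ∧ ∀ μ : PMF X,
    ∃ φ : lp (fun _ : X => ℂ) 1,
      DiamLE (Function.support (φ : X → ℂ)) S ∧
      ∑' x : μ.support, (μ x).toReal *
          ∑' y : {y : X // y ∈ μ.support ∧ dist (x : X) y ≤ R}, ‖φ x - φ y‖
        < ε * ∑' x : μ.support, (μ x).toReal * ‖φ x‖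

/-- The metric sparsification property. The decomposition of `Ω` is given as the set `P` of its
pieces; distinct pieces are disjoint because they have positive distance. -/
def MSP (X : Type u) [MetricSpace X] : Prop :=
  ∃ c : ℝ, 0 < c ∧ ∀ R : ℝ, 0 < R → ∃ S : ℝ, 0 < S ∧ ∀ μ : PMF X,
    ∃ (Ω : Set X) (P : Set (Set X)), Ω = ⋃₀ P ∧ c ≤ mass μ Ω ∧
      (∀ A ∈ P, DiamLE A S) ∧
      (∀ A ∈ P, ∀ B ∈ P, A ≠ B → ENNReal.ofReal R < setDist A B)

/-- A probability mass function viewed as a measure on the σ-algebra of all subsets. -/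
def discreteMeasure {X : Type u} (μ : PMF X) : @Measure X ⊤ :=
  @PMF.toMeasure X ⊤ μ

/-- The Hilbert space `ℓ²(X, μ, H)`. -/
abbrev WeightedL2 {X : Type u} (μ : PMF X) (H : Type v) [NormedAddCommGroup H] :=
  Lp H 2 (discreteMeasure μ)

instance {X : Type u} (μ : PMF X) : @IsProbabilityMeasure X ⊤ (discreteMeasure μ) :=
  @PMF.toMeasure.isProbabilityMeasure X ⊤ μ

/-- The (class of the) function with value `h` at `y` and `0` elsewhere. -/
def pointFunction {X : Type u} (μ : PMF X) {H : Type v} [NormedAddCommGroup H]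
    (y : X) (h : H) : WeightedL2 μ H :=
  indicatorConstLp 2 (μ := discreteMeasure μ) (s := {y}) trivial
    (@measure_ne_top X ⊤ (discreteMeasure μ) _ {y}) h

/-- `T` has propagation at most `R`: its matrix entries `T_{x,y} : h ↦ (T (h at y)) (x)` vanish
when `d(x, y) > R`. The value at `x` of an element of `ℓ²(X, μ, H)` is meaningful exactly for the
points `x` of positive mass; if `y` has mass zero then the function `h at y` is zero. -/
def PropagationLE {X : Type u} [MetricSpace X] {μ : PMF X} {H : Type v}
    [NormedAddCommGroup H] [InnerProductSpace ℂ H]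
    (T : WeightedL2 μ H →L[ℂ] WeightedL2 μ H) (R : ℝ) : Prop :=
  ∀ x ∈ μ.support, ∀ y ∈ μ.support, R < dist x y →
    ∀ h : H, (T (pointFunction μ y h) : X → H) x = 0

/-- The support of an element of `ℓ²(X, μ, H)`. -/
def l2Support {X : Type u} {μ : PMF X} {H : Type v} [NormedAddCommGroup H]
    (φ : WeightedL2 μ H) : Set X :=
  {x | x ∈ μ.support ∧ (φ : X → H) x ≠ 0}

/-- The operator norm localisation property; `H` ranges over the nonzero separable complex
Hilbert spaces (of a given universe). -/
def ONL (X : Type u) [MetricSpace X] : Prop :=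
  ∃ c : ℝ, 0 < c ∧ ∀ R : ℝ, 0 < R → ∃ S : ℝ, 0 < S ∧
    ∀ (μ : PMF X) (H : Type v) [NormedAddCommGroup H] [InnerProductSpace ℂ H]
      [CompleteSpace H] [TopologicalSpace.SeparableSpace H] [Nontrivial H]
      (T : WeightedL2 μ H →L[ℂ] WeightedL2 μ H), PropagationLE T R →
      ∃ φ : WeightedL2 μ H, ‖φ‖ = 1 ∧ DiamLE (l2Support φ) S ∧ c * ‖T‖ ≤ ‖T φ‖

/-- Amenability of a discrete group (Følner condition). -/
def AmenableGroup (G : Type u) [Group G] : Prop :=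
  ∀ (K : Finset G) (ε : ℝ), 0 < ε → ∃ F : Finset G, F.Nonempty ∧
    ∀ k ∈ K, (((k • (F : Set G)) ∆ (F : Set G)).ncard : ℝ) ≤ ε * F.card

/-- A metric on a group is proper if balls (equivalently, balls about `1` for a left-invariant
metric) are finite. -/
def ProperGroupMetric (G : Type u) [Group G] [MetricSpace G] : Prop :=
  ∀ (g : G) (R : ℝ), (Metric.closedBall g R).Finite

end CoarseGeometry

end

/-! Property A gives ULA by averaging: the functions `x ↦ ξ_x(z)` live on balls about `z`, and
summed over `z` their total variation is less than `ε` times their total norm, so one `z` does the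
same. A coarea argument (`exists_level_set`) turns such a function into a set; conversely, a set
with small `2R`-boundary yields the indicator of its `R`-neighbourhood.

ULA gives MSP by greedy removal (`exists_sparse_of_finset`): keep a set, discard its boundary, which
weighs less, and repeat in what remains. Conversely, if every bounded set had a heavy boundary, the
masses of the neighbourhoods of the sparse pieces would grow geometrically while staying disjoint,
until their total exceeds `1`.

MSP gives ONL (`exists_localised_vector`) by sparsifying the measure with density `‖Tφ‖²` for a
nearly norming `φ`: on each piece `Tφ` depends only on `φ` near that piece, so one of the localised
parts of `φ` must be nearly norming. For amenable groups, uniform measures on translates of a Følner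
set give property A. -/

namespace CoarseGeometry

/-! ### Neighbourhoods, diameters and distances of sets -/

section Metric

variable {X : Type u} [MetricSpace X]

theorem diamLE_iff {E : Set X} {S : ℝ} (hS : 0 ≤ S) :
    DiamLE E S ↔ ∀ x ∈ E, ∀ y ∈ E, dist x y ≤ S := by
  simp [DiamLE, Metric.ediam_le_iff, edist_le_ofReal hS]

theorem BoundedGeometry.finite_closedBall (hX : BoundedGeometry X) (x : X) (R : ℝ) :
    (Metric.closedBall x R).Finite := by
  obtain ⟨N, hN⟩ := hX (max R 1) (by positivity)
  exact (Set.finite_of_encard_le_coe (hN x)).subset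
    (Metric.closedBall_subset_closedBall (le_max_left _ _))

theorem DiamLE.finite (hX : BoundedGeometry X) {E : Set X} {S : ℝ} (hS : 0 ≤ S)
    (hE : DiamLE E S) : E.Finite := by
  rcases E.eq_empty_or_nonempty with rfl | ⟨x, hx⟩
  · exact Set.finite_empty
  · exact (hX.finite_closedBall x S).subset fun y hy => (diamLE_iff hS).1 hE y hy x hx

/-- The closed `R`-neighbourhood of a set, with the distance to the set attained. -/
def nbhd (R : ℝ) (E : Set X) : Set X := {y | ∃ x ∈ E, dist y x ≤ R}

theorem subset_nbhd {R : ℝ} (hR : 0 ≤ R) (E : Set X) : E ⊆ nbhd R E :=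
  fun x hx => ⟨x, hx, by simpa using hR⟩

theorem nbhd_nbhd_subset (R T : ℝ) (E : Set X) : nbhd R (nbhd T E) ⊆ nbhd (R + T) E := by
  rintro y ⟨x, ⟨z, hz, hxz⟩, hyx⟩
  exact ⟨z, hz, (dist_triangle y x z).trans (add_le_add hyx hxz)⟩

theorem boundary_eq {R : ℝ} (hR : 0 ≤ R) {E : Set X} (hE : E.Finite) :
    boundary R E = nbhd R E \ E := by
  ext y
  simp [boundary, hE.isCompact.cthickening_eq_biUnion_closedBall hR, nbhd]

theorem DiamLE.nbhd {E : Set X} {S R : ℝ} (hS : 0 ≤ S) (hR : 0 ≤ R) (hE : DiamLE E S) :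
    DiamLE (nbhd R E) (S + 2 * R) := by
  rw [diamLE_iff (by positivity)]
  rintro y ⟨x, hx, hyx⟩ y' ⟨x', hx', hyx'⟩
  have h1 := dist_triangle4 y x x' y'
  have h2 := (diamLE_iff hS).1 hE x hx x' hx'
  rw [dist_comm x' y'] at h1
  linarith

theorem DiamLE.mono {E F : Set X} {S : ℝ} (hE : DiamLE E S) (h : F ⊆ E) : DiamLE F S :=
  (Metric.ediam_mono h).trans hE

theorem lt_dist_of_lt_setDist {A B : Set X} {R : ℝ} (h : ENNReal.ofReal R < setDist A B)
    {x y : X} (hx : x ∈ A) (hy : y ∈ B) : R < dist x y := by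
  have h1 : setDist A B ≤ edist x y := iInf₂_le_of_le x hx (iInf₂_le y hy)
  rw [edist_dist] at h1
  exact lt_of_not_ge fun hle => (h.trans_le h1).not_ge (ENNReal.ofReal_le_ofReal hle)

theorem ofReal_le_setDist {A B : Set X} {R : ℝ} (h : ∀ x ∈ A, ∀ y ∈ B, R ≤ dist x y) :
    ENNReal.ofReal R ≤ setDist A B := by
  refine le_iInf₂ fun x hx => le_iInf₂ fun y hy => ?_
  rw [edist_dist]
  exact ENNReal.ofReal_le_ofReal (h x hx y hy)

end Metric

/-! ### Masses of sets and conditioned measures -/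

section Mass

variable {X : Type u} (μ : PMF X)

theorem toOuterMeasure_le_one (E : Set X) : μ.toOuterMeasure E ≤ 1 := by
  rw [PMF.toOuterMeasure_apply, ← μ.tsum_coe]
  exact ENNReal.tsum_le_tsum fun x => Set.indicator_le_self _ _ x

theorem toOuterMeasure_ne_top (E : Set X) : μ.toOuterMeasure E ≠ ∞ :=
  ((toOuterMeasure_le_one μ E).trans_lt ENNReal.one_lt_top).ne

theorem ofReal_mass (E : Set X) : ENNReal.ofReal (mass μ E) = μ.toOuterMeasure E :=
  ENNReal.ofReal_toReal (toOuterMeasure_ne_top μ E)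

theorem mass_nonneg (E : Set X) : 0 ≤ mass μ E := ENNReal.toReal_nonneg

theorem mass_lt_mul_mass_iff {ε : ℝ} (hε : 0 ≤ ε) (A B : Set X) :
    mass μ A < ε * mass μ B ↔
      μ.toOuterMeasure A < ENNReal.ofReal ε * μ.toOuterMeasure B := by
  rw [← ofReal_mass, ← ofReal_mass, ← ENNReal.ofReal_mul hε]
  refine ⟨fun h => (ENNReal.ofReal_lt_ofReal_iff_of_nonneg (mass_nonneg μ A)).2 h, fun h => ?_⟩
  exact (ENNReal.ofReal_lt_ofReal_iff_of_nonneg (mass_nonneg μ A)).1 h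

theorem toOuterMeasure_union {A B : Set X} (h : Disjoint A B) :
    μ.toOuterMeasure (A ∪ B) = μ.toOuterMeasure A + μ.toOuterMeasure B := by
  simp_rw [PMF.toOuterMeasure_apply, Set.indicator_union_of_disjoint h, ENNReal.tsum_add]

theorem tsum_indicator_sUnion {P : Set (Set X)} (hP : P.PairwiseDisjoint id) (f : X → ℝ≥0∞) :
    ∑' A : P, ∑' x, (A : Set X).indicator f x = ∑' x, (⋃₀ P).indicator f x := by
  rw [ENNReal.tsum_comm]
  refine tsum_congr fun x => ?_
  by_cases hx : x ∈ ⋃₀ P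
  · obtain ⟨A, hA, hxA⟩ := hx
    rw [tsum_eq_single (⟨A, hA⟩ : P), Set.indicator_of_mem hxA,
      Set.indicator_of_mem (Set.mem_sUnion_of_mem hxA hA)]
    rintro ⟨B, hB⟩ hne
    refine Set.indicator_of_notMem (fun hxB => hne ?_) _
    exact Subtype.ext (hP.elim_set hB hA x hxB hxA)
  · rw [Set.indicator_of_notMem hx]
    refine ENNReal.tsum_eq_zero.2 fun A => Set.indicator_of_notMem (fun h => hx ?_) _
    exact Set.mem_sUnion_of_mem h A.2

theorem tsum_indicator_le_of_disjoint {ι : Type*} {A : ι → Set X}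
    (hA : ∀ i j x, x ∈ A i → x ∈ A j → i = j) (f : X → ℝ≥0∞) :
    ∑' i, ∑' x, (A i).indicator f x ≤ ∑' x, f x := by
  rw [ENNReal.tsum_comm]
  refine ENNReal.tsum_le_tsum fun x => ?_
  by_cases hx : ∃ i, x ∈ A i
  · obtain ⟨i, hi⟩ := hx
    rw [tsum_eq_single i, Set.indicator_of_mem hi]
    exact fun j hj => Set.indicator_of_notMem (fun h => hj (hA j i x h hi)) _
  · simp only [not_exists] at hx
    simp [hx]

theorem toOuterMeasure_filter {F : Set X} (h : ∃ a ∈ F, a ∈ μ.support) (A : Set X) :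
    (μ.filter F h).toOuterMeasure A = μ.toOuterMeasure (A ∩ F) * (μ.toOuterMeasure F)⁻¹ := by
  simp_rw [PMF.toOuterMeasure_apply, ← ENNReal.tsum_mul_right]
  refine tsum_congr fun x => ?_
  by_cases hA : x ∈ A <;> by_cases hF : x ∈ F <;>
    simp [Set.indicator, hA, hF, PMF.filter_apply]

theorem exists_finset_half_le (μ : PMF X) :
    ∃ F : Finset X, (2 : ℝ≥0∞)⁻¹ ≤ μ.toOuterMeasure F := by
  have h : (2 : ℝ≥0∞)⁻¹ < ∑' x, μ x := by
    rw [μ.tsum_coe]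
    simp
  rw [ENNReal.tsum_eq_iSup_sum] at h
  obtain ⟨F, hF⟩ := lt_iSup_iff.1 h
  exact ⟨F, by rw [PMF.toOuterMeasure_apply_finset]; exact hF.le⟩

end Mass

/-! ### ULA for sets is equivalent to metric sparsification -/

section Sparsification

variable {X : Type u} [MetricSpace X]

theorem pairwiseDisjoint_of_setDist {P : Set (Set X)} {R : ℝ} (hR : 0 ≤ R)
    (hP : ∀ A ∈ P, ∀ B ∈ P, A ≠ B → ENNReal.ofReal R < setDist A B) :
    P.PairwiseDisjoint id := by
  intro A hA B hB hAB
  refine Set.disjoint_left.2 fun x hx hx' => ?_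
  have := lt_dist_of_lt_setDist (hP A hA B hB hAB) hx hx'
  simp at this
  linarith

theorem eq_of_mem_nbhd {P : Set (Set X)} {R T : ℝ} (hT : 2 * T ≤ R)
    (hP : ∀ A ∈ P, ∀ B ∈ P, A ≠ B → ENNReal.ofReal R < setDist A B)
    (A B : P) (x : X) (hA : x ∈ nbhd T (A : Set X)) (hB : x ∈ nbhd T (B : Set X)) : A = B := by
  by_contra hne
  obtain ⟨a, ha, hxa⟩ := hA
  obtain ⟨b, hb, hxb⟩ := hB
  have h1 := lt_dist_of_lt_setDist (hP A A.2 B B.2 fun h => hne (Subtype.ext h)) ha hb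
  have h2 := dist_triangle_left a b x
  linarith

theorem ULAmu_of_MSP (hX : BoundedGeometry X) (h : MSP X) : ULAmu X := by
  obtain ⟨c, hc, h⟩ := h
  intro R hR ε hε
  obtain ⟨n, hn⟩ := pow_unbounded_of_one_lt (1 / c) (show 1 < 1 + ε by linarith)
  -- Separation `2nR` makes the `nR`-neighbourhoods of the pieces disjoint; the extra `R` keeps the
  -- scale positive when `n = 0`.
  obtain ⟨S, hS, h⟩ := h (2 * (n * R) + R) (by positivity)
  refine ⟨S + 2 * (n * R), by positivity, fun μ => ?_⟩
  obtain ⟨Ω, P, rfl, hΩ, hdiam, hsep⟩ := h μ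
  by_contra! hcon
  -- Each enlargement by `R` adds a boundary of at least `ε` times the current mass.
  have key : ∀ A ∈ P, ∀ k : ℕ, k ≤ n →
      ENNReal.ofReal (1 + ε) ^ k * μ.toOuterMeasure A ≤ μ.toOuterMeasure (nbhd (k * R) A) := by
    intro A hA k
    induction k with
    | zero =>
      intro _
      simpa using measure_mono (μ := μ.toOuterMeasure) (subset_nbhd le_rfl A)
    | succ k ih =>
      intro hk
      have hd : DiamLE (nbhd (k * R) A) (S + 2 * (k * R)) :=
        (hdiam A hA).nbhd hS.le (by positivity)
      have hfin : (nbhd (k * R) A).Finite := hd.finite hX (by positivity)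
      have hkn : (k : ℝ) ≤ n := by exact_mod_cast (Nat.le_of_succ_le hk)
      have hd' : DiamLE (nbhd (k * R) A) (S + 2 * (n * R)) :=
        hd.trans (ENNReal.ofReal_le_ofReal (by gcongr))
      have h1 := hcon _ hfin hd'
      rw [← not_lt, mass_lt_mul_mass_iff μ hε.le, not_lt, boundary_eq hR.le hfin] at h1
      calc ENNReal.ofReal (1 + ε) ^ (k + 1) * μ.toOuterMeasure A
          = ENNReal.ofReal (1 + ε) * (ENNReal.ofReal (1 + ε) ^ k * μ.toOuterMeasure A) := by
            ring
        _ ≤ ENNReal.ofReal (1 + ε) * μ.toOuterMeasure (nbhd (k * R) A) := by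
            gcongr
            exact ih (by omega)
        _ = μ.toOuterMeasure (nbhd (k * R) A)
              + ENNReal.ofReal ε * μ.toOuterMeasure (nbhd (k * R) A) := by
            rw [ENNReal.ofReal_add zero_le_one hε.le, add_mul, ENNReal.ofReal_one, one_mul]
        _ ≤ μ.toOuterMeasure (nbhd (k * R) A)
              + μ.toOuterMeasure (nbhd R (nbhd (k * R) A) \ nbhd (k * R) A) := by gcongr
        _ = μ.toOuterMeasure (nbhd R (nbhd (k * R) A)) := by
            rw [← toOuterMeasure_union μ Set.disjoint_sdiff_right,
              Set.union_sdiff_cancel (subset_nbhd hR.le _)]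
        _ ≤ _ := by
            refine measure_mono ((nbhd_nbhd_subset _ _ _).trans_eq ?_)
            push_cast
            congr 1
            ring
  have hsum : ENNReal.ofReal (1 + ε) ^ n * μ.toOuterMeasure (⋃₀ P) ≤ 1 := by
    rw [PMF.toOuterMeasure_apply, ← tsum_indicator_sUnion
      (pairwiseDisjoint_of_setDist (by positivity) hsep), ← ENNReal.tsum_mul_left, ← μ.tsum_coe]
    refine le_trans (ENNReal.tsum_le_tsum fun A => ?_) (tsum_indicator_le_of_disjoint
      (A := fun A : P => nbhd (n * R) (A : Set X))
      (eq_of_mem_nbhd (T := n * R) (by linarith) hsep) μ)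
    simpa only [PMF.toOuterMeasure_apply] using key A A.2 n le_rfl
  rw [← ofReal_mass, ← ENNReal.ofReal_pow (by positivity), ← ENNReal.ofReal_mul (by positivity),
    ENNReal.ofReal_le_one] at hsum
  have : 1 < (1 + ε) ^ n * c := by rwa [div_lt_iff₀ hc] at hn
  have : (1 + ε) ^ n * c ≤ (1 + ε) ^ n * mass μ (⋃₀ P) := by gcongr
  linarith

/-- Induction on `F`: conditioning `μ` on `F` yields a piece `E ∩ F` heavier than the part of the
boundary of `E` in `F`. Discarding that boundary loses at most as much as is kept, whence the factor
`2`. -/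
theorem exists_sparse_of_finset {R S : ℝ} (hR : 0 ≤ R)
    (h : ∀ μ : PMF X, ∃ E : Set X, E.Finite ∧ DiamLE E S ∧ mass μ (boundary R E) < 1 * mass μ E)
    (μ : PMF X) (F : Finset X) :
    ∃ P : Set (Set X), (∀ A ∈ P, A ⊆ F) ∧ (∀ A ∈ P, DiamLE A S) ∧
      (∀ A ∈ P, ∀ B ∈ P, A ≠ B → ∀ x ∈ A, ∀ y ∈ B, R < dist x y) ∧
      μ.toOuterMeasure F ≤ 2 * μ.toOuterMeasure (⋃₀ P) := by
  classical
  induction F using Finset.strongInduction with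
  | H F ih =>
  by_cases hF : ∃ a ∈ (F : Set X), a ∈ μ.support
  · have hpos : μ.toOuterMeasure (F : Set X) ≠ 0 := by
      rw [Ne, PMF.toOuterMeasure_apply_eq_zero_iff, Set.not_disjoint_iff]
      obtain ⟨a, h1, h2⟩ := hF
      exact ⟨a, h2, h1⟩
    obtain ⟨E, hEfin, hEd, hE⟩ := h (μ.filter F hF)
    rw [mass_lt_mul_mass_iff _ zero_le_one, ENNReal.ofReal_one, one_mul, toOuterMeasure_filter,
      toOuterMeasure_filter] at hE
    -- The normalising factor of the conditioned measure cancels, leaving an inequality for `μ`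
    -- itself.
    replace hE := lt_of_mul_lt_mul_right' hE
    rw [boundary_eq hR hEfin] at hE
    have hne : (E ∩ F).Nonempty := by
      by_contra hcon
      rw [Set.not_nonempty_iff_eq_empty.1 hcon] at hE
      simp at hE
    let F' : Finset X := F.filter fun x => x ∉ nbhd R (E ∩ F)
    obtain ⟨e, he⟩ := hne
    obtain ⟨P, hPF, hPd, hPs, hPm⟩ := ih F'
      (Finset.filter_ssubset.2 ⟨e, he.2, not_not.2 (subset_nbhd hR _ he)⟩)
    have hsep : ∀ A ∈ P, ∀ x ∈ E ∩ F, ∀ y ∈ A, R < dist y x := by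
      intro A hA x hx y hy
      by_contra! hle
      exact (Finset.mem_filter.1 (hPF A hA hy)).2 ⟨x, hx, hle⟩
    refine ⟨insert (E ∩ F) P, ?_, ?_, ?_, ?_⟩
    · rintro A (rfl | hA)
      · exact Set.inter_subset_right
      · exact (hPF A hA).trans (Finset.coe_subset.2 (Finset.filter_subset _ _))
    · rintro A (rfl | hA)
      · exact hEd.mono Set.inter_subset_left
      · exact hPd A hA
    · rintro A (rfl | hA) B (rfl | hB) hAB x hx y hy
      · exact absurd rfl hAB
      · rw [dist_comm]
        exact hsep B hB x hx y hy
      · exact hsep A hA y hy x hx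
      · exact hPs A hA B hB hAB x hx y hy
    · have hdisj : Disjoint (E ∩ F) (⋃₀ P) := by
        refine Set.disjoint_left.2 fun x hx hx' => ?_
        obtain ⟨A, hA, hxA⟩ := hx'
        have := hsep A hA x hx x hxA
        simp at this
        linarith
      have hsub : (F : Set X) ⊆ ((E ∩ F) ∪ ((nbhd R E \ E) ∩ F)) ∪ (F' : Set X) := by
        intro x hx
        by_cases h1 : x ∈ nbhd R (E ∩ F)
        · left
          by_cases h2 : x ∈ E
          · exact Or.inl ⟨h2, hx⟩
          · obtain ⟨y, hy, hxy⟩ := h1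
            exact Or.inr ⟨⟨⟨y, hy.1, hxy⟩, h2⟩, hx⟩
        · exact Or.inr (Finset.mem_coe.2 (Finset.mem_filter.2 ⟨hx, h1⟩))
      rw [Set.sUnion_insert, toOuterMeasure_union μ hdisj]
      calc μ.toOuterMeasure F
          ≤ μ.toOuterMeasure (E ∩ F) + μ.toOuterMeasure ((nbhd R E \ E) ∩ F)
              + μ.toOuterMeasure F' :=
            (measure_mono hsub).trans ((measure_union_le _ _).trans
              (add_le_add_left (measure_union_le _ _) _))
        _ ≤ μ.toOuterMeasure (E ∩ F) + μ.toOuterMeasure (E ∩ F)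
              + 2 * μ.toOuterMeasure (⋃₀ P) := by gcongr
        _ = _ := by ring
  · refine ⟨∅, by simp, by simp, by simp, ?_⟩
    have : μ.toOuterMeasure (F : Set X) = 0 := by
      rw [PMF.toOuterMeasure_apply_eq_zero_iff, Set.disjoint_left]
      exact fun a h1 h2 => hF ⟨a, h2, h1⟩
    rw [this]
    exact zero_le

theorem MSP_of_ULAmu (h : ULAmu X) : MSP X := by
  -- One factor `1/2` comes from passing to a finite set, the other from the discarded boundaries.
  -- The scale `R + 1` below is used because pointwise distances `> R` would only give an infimum `≥
  -- R`.
  refine ⟨1 / 4, by norm_num, fun R hR => ?_⟩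
  obtain ⟨S, hS, h⟩ := h (R + 1) (by positivity) 1 one_pos
  refine ⟨S, hS, fun μ => ?_⟩
  obtain ⟨F, hF⟩ := exists_finset_half_le μ
  obtain ⟨P, -, hd, hs, hm⟩ := exists_sparse_of_finset (by positivity) h μ F
  refine ⟨⋃₀ P, P, rfl, ?_, hd, fun A hA B hB hAB => ?_⟩
  · have h1 := hF.trans hm
    rw [← ofReal_mass, show (2 : ℝ≥0∞)⁻¹ = ENNReal.ofReal (1 / 2) by
      rw [one_div, ENNReal.ofReal_inv_of_pos two_pos]; simp,
      show (2 : ℝ≥0∞) = ENNReal.ofReal 2 by simp, ← ENNReal.ofReal_mul two_pos.le,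
      ENNReal.ofReal_le_ofReal_iff (mul_nonneg two_pos.le (mass_nonneg μ _))] at h1
    linarith
  · refine lt_of_lt_of_le ?_ (ofReal_le_setDist fun x hx y hy => (hs A hA B hB hAB x hx y hy).le)
    exact (ENNReal.ofReal_lt_ofReal_iff (by positivity)).2 (by linarith)

end Sparsification

/-! ### Sums over the support of a measure -/

theorem tsum_support_le_one {X : Type u} (μ : PMF X) : ∑' x : μ.support, μ x ≤ 1 := by
  rw [tsum_subtype μ.support μ]
  simpa only [PMF.toOuterMeasure_apply] using toOuterMeasure_le_one μ μ.support

theorem toOuterMeasure_eq_tsum_support {X : Type u} (μ : PMF X) (A : Set X) :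
    μ.toOuterMeasure A = ∑' x : μ.support, μ x * A.indicator 1 (x : X) := by
  rw [PMF.toOuterMeasure_apply, tsum_subtype μ.support fun x => μ x * A.indicator 1 x]
  refine tsum_congr fun x => ?_
  by_cases hx : x ∈ μ.support
  · by_cases hA : x ∈ A <;> simp [hx, hA]
  · rw [Set.indicator_of_notMem hx]
    have : μ x = 0 := by simpa using hx
    simp [Set.indicator, this]

section WeightedNorm

variable {X : Type u} {V : Type*} [NormedAddCommGroup V]

/-- The `ℓ¹(μ)`-norm of `φ`. -/
noncomputable def weightedNorm (μ : PMF X) (φ : X → V) : ℝ≥0∞ :=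
  ∑' x : μ.support, μ x * ‖φ x‖ₑ

theorem toReal_weightedNorm (μ : PMF X) (φ : X → V) :
    (weightedNorm μ φ).toReal = ∑' x : μ.support, (μ x).toReal * ‖φ x‖ := by
  rw [weightedNorm, ENNReal.tsum_toReal_eq fun x : μ.support =>
    ENNReal.mul_ne_top (μ.apply_ne_top x) enorm_ne_top]
  simp

end WeightedNorm

/-! ### Variation of functions, the coarea inequality, and property A -/

section Variation

variable {X : Type u} [MetricSpace X] {V : Type*} [NormedAddCommGroup V]

/-- The `R`-variation of `φ` at the point `x`, summed over the support of `μ`. -/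
noncomputable def localVariation (μ : PMF X) (R : ℝ) (φ : X → V) (x : X) : ℝ≥0∞ :=
  ∑' y : {y : X // y ∈ μ.support ∧ dist x y ≤ R}, ‖φ x - φ y‖ₑ

/-- The total `R`-variation of `φ` with respect to `μ`. -/
noncomputable def variation (μ : PMF X) (R : ℝ) (φ : X → V) : ℝ≥0∞ :=
  ∑' x : μ.support, μ x * localVariation μ R φ x

theorem tsum_ball_const_le {R : ℝ} {N : ℕ} (hN : ∀ x : X, (Metric.closedBall x R).encard ≤ N)
    (μ : PMF X) (x : X) (C : ℝ≥0∞) :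
    ∑' _ : {y : X // y ∈ μ.support ∧ dist x y ≤ R}, C ≤ N * C := by
  refine (ENNReal.tsum_set_const {y : X | y ∈ μ.support ∧ dist x y ≤ R} C).trans_le ?_
  gcongr
  have h : {y : X | y ∈ μ.support ∧ dist x y ≤ R} ⊆ Metric.closedBall x R := fun y hy => by
    simpa [dist_comm] using hy.2
  exact_mod_cast (Set.encard_le_encard h).trans (hN x)

theorem localVariation_le {R : ℝ} {N : ℕ} (hN : ∀ x : X, (Metric.closedBall x R).encard ≤ N)
    (μ : PMF X) {φ : X → V} {x : X} {C : ℝ≥0∞} (hC : ∀ y, dist x y ≤ R → ‖φ x - φ y‖ₑ ≤ C) :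
    localVariation μ R φ x ≤ N * C :=
  (ENNReal.tsum_le_tsum fun y : {y : X // y ∈ μ.support ∧ dist x y ≤ R} => hC y y.2.2).trans
    (tsum_ball_const_le hN μ x C)

theorem variation_ne_top {R : ℝ} {N : ℕ} (hN : ∀ x : X, (Metric.closedBall x R).encard ≤ N)
    (μ : PMF X) {φ : X → V} {C : ℝ≥0∞} (hC : C ≠ ∞) (hφ : ∀ x, ‖φ x‖ₑ ≤ C) :
    (∀ x, localVariation μ R φ x ≠ ∞) ∧ variation μ R φ ≠ ∞ := by
  have hloc : ∀ x, localVariation μ R φ x ≤ N * (C + C) := fun x =>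
    localVariation_le hN μ fun y _ => (enorm_sub_le).trans (add_le_add (hφ x) (hφ y))
  have hfin : (N : ℝ≥0∞) * (C + C) ≠ ∞ := by finiteness
  refine ⟨fun x => ((hloc x).trans_lt hfin.lt_top).ne, ?_⟩
  refine ne_top_of_le_ne_top hfin ?_
  calc variation μ R φ ≤ ∑' x : μ.support, μ x * (N * (C + C)) :=
        ENNReal.tsum_le_tsum fun x => by gcongr; exact hloc x
    _ ≤ 1 * (N * (C + C)) := by
        rw [ENNReal.tsum_mul_right]
        gcongr
        exact tsum_support_le_one μ
    _ = _ := one_mul _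

theorem toReal_variation (μ : PMF X) (R : ℝ) (φ : X → V)
    (h : ∀ x, localVariation μ R φ x ≠ ∞) :
    (variation μ R φ).toReal = ∑' x : μ.support, (μ x).toReal *
      ∑' y : {y : X // y ∈ μ.support ∧ dist (x : X) y ≤ R}, ‖φ x - φ y‖ := by
  rw [variation, ENNReal.tsum_toReal_eq fun x : μ.support =>
    ENNReal.mul_ne_top (μ.apply_ne_top x) (h x)]
  refine tsum_congr fun x => ?_
  rw [ENNReal.toReal_mul, localVariation, ENNReal.tsum_toReal_eq fun y => enorm_ne_top]
  simp

/-- A support point `x` in the boundary of the superlevel set has a neighbour `y` with `f x ≤ t < f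
y`, so at least one term of the inner sum is `1`. -/
theorem toOuterMeasure_boundary_le (μ : PMF X) (R : ℝ) (f : X → ℝ) (t : ℝ) :
    μ.toOuterMeasure (nbhd R {x | x ∈ μ.support ∧ t < f x} \ {x | x ∈ μ.support ∧ t < f x}) ≤
      ∑' x : μ.support, μ x * ∑' y : {y : X // y ∈ μ.support ∧ dist (x : X) y ≤ R},
        (Set.Ico (f x) (f y)).indicator 1 t := by
  rw [toOuterMeasure_eq_tsum_support]
  refine ENNReal.tsum_le_tsum fun x => ?_
  gcongr
  by_cases hx : (x : X) ∈
      nbhd R {x | x ∈ μ.support ∧ t < f x} \ {x | x ∈ μ.support ∧ t < f x}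
  swap
  · rw [Set.indicator_of_notMem hx]
    exact zero_le
  rw [Set.indicator_of_mem hx]
  obtain ⟨⟨y, hy, hxy⟩, hxE⟩ := hx
  have hxt : f x ≤ t := not_lt.1 fun h => hxE ⟨x.2, h⟩
  refine le_trans ?_ (ENNReal.le_tsum (⟨y, hy.1, hxy⟩ :
    {y : X // y ∈ μ.support ∧ dist (x : X) y ≤ R}))
  rw [Set.indicator_of_mem (show t ∈ Set.Ico (f x) (f y) from ⟨hxt, hy.2⟩)]
  rfl

/-- Coarea argument: if every level `t ≥ 0` failed, integrating over `t` would contradict `h`, since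
the interval `[a, b)` has length `(b - a)⁺`. -/
theorem exists_level_set (μ : PMF X) {R ε : ℝ} {f : X → ℝ} (hf : ∀ x, 0 ≤ f x)
    (h : variation μ R f < ENNReal.ofReal ε * weightedNorm μ f) :
    ∃ t : ℝ, 0 ≤ t ∧
      μ.toOuterMeasure
          (nbhd R {x | x ∈ μ.support ∧ t < f x} \ {x | x ∈ μ.support ∧ t < f x}) <
        ENNReal.ofReal ε * μ.toOuterMeasure {x | x ∈ μ.support ∧ t < f x} := by
  by_contra! H
  refine h.not_ge ?_
  have hcount : Countable μ.support := μ.support_countable.to_subtype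
  have hcount' : ∀ x : X, Countable {y : X // y ∈ μ.support ∧ dist x y ≤ R} := fun x =>
    (μ.support_countable.mono fun y hy => hy.1 :
      {y : X | y ∈ μ.support ∧ dist x y ≤ R}.Countable).to_subtype
  have hmeas : ∀ a b : ℝ, Measurable ((Set.Ico a b).indicator (1 : ℝ → ℝ≥0∞)) := fun a b =>
    measurable_one.indicator measurableSet_Ico
  have hint : ∀ a b : ℝ, ∫⁻ t, (Set.Ico a b).indicator (1 : ℝ → ℝ≥0∞) t
      = ENNReal.ofReal (b - a) := fun a b => by
    rw [lintegral_indicator_one measurableSet_Ico, Real.volume_Ico]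
  have hpt : ∀ t : ℝ, ENNReal.ofReal ε * ∑' x : μ.support, μ x *
        (Set.Ico 0 (f x)).indicator 1 t ≤
      ∑' x : μ.support, μ x * ∑' y : {y : X // y ∈ μ.support ∧ dist (x : X) y ≤ R},
        (Set.Ico (f x) (f y)).indicator 1 t := by
    intro t
    rcases lt_or_ge t 0 with ht | ht
    · have : ∀ x : μ.support, (Set.Ico 0 (f x)).indicator (1 : ℝ → ℝ≥0∞) t = 0 := fun x =>
        Set.indicator_of_notMem (fun h => ht.not_ge h.1) _
      simp [this]
    · refine le_trans (le_of_eq ?_) ((H t ht).trans (toOuterMeasure_boundary_le μ R f t))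
      rw [toOuterMeasure_eq_tsum_support]
      congr 1
      refine tsum_congr fun x => ?_
      congr 1
      by_cases hx : t < f x
      · rw [Set.indicator_of_mem (show t ∈ Set.Ico 0 (f x) from ⟨ht, hx⟩), Set.indicator_of_mem
          (show (x : X) ∈ {x | x ∈ μ.support ∧ t < f x} from ⟨x.2, hx⟩)]
        rfl
      · rw [Set.indicator_of_notMem (fun h => hx h.2), Set.indicator_of_notMem (fun h => hx h.2)]
  have hI := lintegral_mono (μ := volume) hpt
  rw [lintegral_const_mul _ (Measurable.tsum fun x => (hmeas _ _).const_mul _),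
    lintegral_tsum fun x => ((hmeas _ _).const_mul _).aemeasurable,
    lintegral_tsum fun x =>
      ((Measurable.tsum fun y => hmeas _ _).const_mul _).aemeasurable] at hI
  calc ENNReal.ofReal ε * weightedNorm μ f
      = _ := by
        rw [weightedNorm]
        congr 1
        refine tsum_congr fun x => ?_
        rw [lintegral_const_mul _ (hmeas _ _), hint, sub_zero, Real.enorm_of_nonneg (hf x)]
    _ ≤ _ := hI
    _ ≤ variation μ R f := by
        refine ENNReal.tsum_le_tsum fun x => ?_
        rw [lintegral_const_mul _ (Measurable.tsum fun y => hmeas _ _),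
          lintegral_tsum fun y => (hmeas _ _).aemeasurable]
        refine mul_le_mul_right (ENNReal.tsum_le_tsum fun y => ?_) _
        rw [hint, Real.enorm_eq_ofReal_abs, abs_sub_comm]
        exact ENNReal.ofReal_le_ofReal (le_abs_self _)

theorem exists_set_of_function (hX : BoundedGeometry X) (μ : PMF X) {R ε S : ℝ} (hR : 0 ≤ R)
    (hε : 0 ≤ ε) (hS : 0 ≤ S) {φ : X → V} (hd : DiamLE (Function.support φ) S)
    (h : variation μ R φ < ENNReal.ofReal ε * weightedNorm μ φ) :
    ∃ E : Set X, E.Finite ∧ DiamLE E S ∧ mass μ (boundary R E) < ε * mass μ E := by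
  have h' : variation μ R (fun x => ‖φ x‖) <
      ENNReal.ofReal ε * weightedNorm μ (fun x => ‖φ x‖) := by
    refine lt_of_le_of_lt ?_ (h.trans_eq (by simp [weightedNorm]))
    refine ENNReal.tsum_le_tsum fun x => mul_le_mul_right (ENNReal.tsum_le_tsum fun y => ?_) _
    rw [← ofReal_norm, ← ofReal_norm]
    exact ENNReal.ofReal_le_ofReal (abs_norm_sub_norm_le _ _)
  obtain ⟨t, ht, hlt⟩ := exists_level_set μ (fun x => norm_nonneg _) h'
  have hsub : {x | x ∈ μ.support ∧ t < ‖φ x‖} ⊆ Function.support φ := fun x hx =>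
    norm_pos_iff.1 (ht.trans_lt hx.2)
  have hd' := hd.mono hsub
  have hfin := hd'.finite hX hS
  refine ⟨_, hfin, hd', ?_⟩
  rwa [mass_lt_mul_mass_iff μ hε, boundary_eq hR hfin]

theorem ULAmu_of_ULAmuFun (hX : BoundedGeometry X) (h : ULAmuFun X) : ULAmu X := by
  intro R hR ε hε
  obtain ⟨S, hS, h⟩ := h R hR ε hε
  obtain ⟨N, hN⟩ := hX R hR
  refine ⟨S, hS, fun μ => ?_⟩
  obtain ⟨φ, hd, hlt⟩ := h μ
  have hb : ∀ x, ‖φ x‖ₑ ≤ ‖φ‖ₑ := fun x =>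
    enorm_le_iff_norm_le.2 (lp.norm_apply_le_norm one_ne_zero φ x)
  obtain ⟨h1, h2⟩ := variation_ne_top hN μ enorm_ne_top hb
  refine exists_set_of_function hX μ hR.le hε.le hS.le hd ?_
  rw [← toReal_variation μ R _ h1, ← toReal_weightedNorm] at hlt
  -- An infinite norm would have real value `0`, which the strict inequality excludes.
  have hw : weightedNorm μ (φ : X → ℂ) ≠ ∞ := by
    intro htop
    rw [htop] at hlt
    simp only [ENNReal.toReal_top, mul_zero] at hlt
    exact ENNReal.toReal_nonneg.not_gt hlt
  rw [← ENNReal.ofReal_toReal h2, ← ENNReal.ofReal_toReal hw, ← ENNReal.ofReal_mul hε.le]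
  exact (ENNReal.ofReal_lt_ofReal_iff_of_nonneg ENNReal.toReal_nonneg).2 hlt

theorem ULAmuFun_of_ULAmu (hX : BoundedGeometry X) (h : ULAmu X) : ULAmuFun X := by
  classical
  intro R hR ε hε
  obtain ⟨N, hN⟩ := hX R hR
  -- The indicator of `nbhd R E` varies at scale `R` only at points of `nbhd (2 * R) E \ E`, with at
  -- most `N` neighbours each. Dividing by `N + 1` also covers `N = 0` and gives strictness.
  obtain ⟨S, hS, h⟩ := h (2 * R) (by positivity) (ε / (N + 1)) (by positivity)
  refine ⟨S + 2 * R, by positivity, fun μ => ?_⟩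
  obtain ⟨E, hEfin, hEd, hE⟩ := h μ
  have hd : DiamLE (nbhd R E) (S + 2 * R) := hEd.nbhd hS.le hR.le
  have hfin : (nbhd R E).Finite := hd.finite hX (by positivity)
  rw [mass_lt_mul_mass_iff μ (by positivity), boundary_eq (by positivity) hEfin] at hE
  let f : X → ℂ := (nbhd R E).indicator 1
  have hmem : Memℓp f 1 := by
    refine memℓp_gen ?_
    refine summable_of_hasFiniteSupport (hfin.subset fun x hx => ?_)
    by_contra hcon
    simp [f, hcon] at hx
  have hb : ∀ x, ‖f x‖ₑ ≤ 1 := fun x => by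
    by_cases hx : x ∈ nbhd R E <;> simp [f, hx]
  obtain ⟨h1, h2⟩ := variation_ne_top hN μ ENNReal.one_ne_top hb
  have hwn : weightedNorm μ f = μ.toOuterMeasure (nbhd R E) := by
    rw [toOuterMeasure_eq_tsum_support, weightedNorm]
    refine tsum_congr fun x => ?_
    by_cases hx : (x : X) ∈ nbhd R E <;> simp [f, hx]
  have hloc : ∀ x, localVariation μ R f x ≤
      N * (nbhd (2 * R) E \ E).indicator 1 x := by
    intro x
    refine localVariation_le hN μ fun y hxy => ?_
    by_cases hx : x ∈ nbhd (2 * R) E \ E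
    · rw [Set.indicator_of_mem hx]
      by_cases hx' : x ∈ nbhd R E <;> by_cases hy' : y ∈ nbhd R E <;> simp [f, hx', hy']
    · have hiff : x ∈ nbhd R E ↔ y ∈ nbhd R E := by
        constructor
        · rintro ⟨z, hz, hxz⟩
          have hxE : x ∈ E := by
            by_contra hxE
            exact hx ⟨⟨z, hz, hxz.trans (by linarith)⟩, hxE⟩
          exact ⟨x, hxE, by rwa [dist_comm]⟩
        · rintro ⟨z, hz, hyz⟩
          have hxE : x ∈ E := by
            by_contra hxE
            exact hx ⟨⟨z, hz, (dist_triangle x y z).trans (by linarith)⟩, hxE⟩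
          exact subset_nbhd hR.le E hxE
      by_cases hy' : y ∈ nbhd R E <;> simp [f, hiff, hy']
  have hvar : variation μ R f ≤ N * μ.toOuterMeasure (nbhd (2 * R) E \ E) := by
    rw [toOuterMeasure_eq_tsum_support, variation, ← ENNReal.tsum_mul_left]
    refine ENNReal.tsum_le_tsum fun x => ?_
    calc μ x * localVariation μ R f x ≤ μ x * (N * _) := mul_le_mul_right (hloc x) _
      _ = _ := by ring
  refine ⟨⟨f, hmem⟩, hd.mono fun x hx => ?_, ?_⟩
  · by_contra hcon
    exact hx (by simp [f, hcon])
  · change ∑' x : μ.support, (μ x).toReal *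
          ∑' y : {y : X // y ∈ μ.support ∧ dist (x : X) y ≤ R}, ‖f x - f y‖
        < ε * ∑' x : μ.support, (μ x).toReal * ‖f x‖
    rw [← toReal_variation μ R f h1, ← toReal_weightedNorm, hwn]
    have hmono : mass μ E ≤ mass μ (nbhd R E) :=
      ENNReal.toReal_mono (toOuterMeasure_ne_top _ _) (measure_mono (subset_nbhd hR.le E))
    rw [← mass_lt_mul_mass_iff μ (by positivity)] at hE
    have hpos : 0 < mass μ E := by
      have := (mass_nonneg μ _).trans_lt hE
      exact pos_of_mul_pos_right this (by positivity)
    calc (variation μ R f).toReal ≤ N * mass μ (nbhd (2 * R) E \ E) := by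
          have := ENNReal.toReal_mono
            (ENNReal.mul_ne_top (by simp) (toOuterMeasure_ne_top _ _)) hvar
          simpa [mass] using this
      _ ≤ N * (ε / (N + 1) * mass μ E) := by gcongr
      _ < (N + 1) * (ε / (N + 1) * mass μ E) := by gcongr; linarith
      _ = ε * mass μ E := by field_simp
      _ ≤ ε * mass μ (nbhd R E) := by gcongr

theorem ULAmu_of_propertyA (hX : BoundedGeometry X) (h : PropertyA X) : ULAmu X := by
  intro R hR ε hε
  obtain ⟨N, hN⟩ := hX R hR
  obtain ⟨S, hS, ξ, hξ, hsupp⟩ := h R hR (ε / (N + 1)) (by positivity)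
  refine ⟨2 * S, by positivity, fun μ => ?_⟩
  let φ : X → X → ℝ := fun z x => (ξ x z).toReal
  have hl1 : ∀ x y, dist x y ≤ R → ∑' z, ‖φ z x - φ z y‖ₑ ≤ ENNReal.ofReal (ε / (N + 1)) := by
    intro x y hxy
    have hs : ∀ w, Summable fun z => (ξ w z).toReal := fun w =>
      ENNReal.summable_toReal (ξ w).tsum_coe_ne_top
    have : ∑' z, ‖φ z x - φ z y‖ₑ = ENNReal.ofReal (∑' z, |φ z x - φ z y|) := by
      rw [ENNReal.ofReal_tsum_of_nonneg (fun z => abs_nonneg _) ((hs x).sub (hs y)).abs]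
      exact tsum_congr fun z => Real.enorm_eq_ofReal_abs _
    rw [this]
    exact ENNReal.ofReal_le_ofReal (hξ x y hxy).le
  have hvar : ∑' z, variation μ R (φ z) ≤ ENNReal.ofReal (N * (ε / (N + 1))) := by
    unfold variation localVariation
    rw [ENNReal.tsum_comm]
    calc _ ≤ ∑' x : μ.support, μ x * (N * ENNReal.ofReal (ε / (N + 1))) := by
          refine ENNReal.tsum_le_tsum fun x => ?_
          rw [ENNReal.tsum_mul_left, ENNReal.tsum_comm]
          refine mul_le_mul_right ?_ _
          exact (ENNReal.tsum_le_tsum fun y : {y : X // y ∈ μ.support ∧ dist (x : X) y ≤ R} =>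
            hl1 x y y.2.2).trans (tsum_ball_const_le hN μ x _)
      _ ≤ 1 * (N * ENNReal.ofReal (ε / (N + 1))) := by
          rw [ENNReal.tsum_mul_right]
          gcongr
          exact tsum_support_le_one μ
      _ = _ := by rw [one_mul, ENNReal.ofReal_mul (by positivity), ENNReal.ofReal_natCast]
  have hnorm : ∑' z, ENNReal.ofReal ε * weightedNorm μ (φ z) = ENNReal.ofReal ε := by
    have h1 : ∀ x, ∑' z, ‖φ z x‖ₑ = 1 := fun x => by
      rw [← (ξ x).tsum_coe]
      refine tsum_congr fun z => ?_
      rw [Real.enorm_of_nonneg ENNReal.toReal_nonneg,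
        ENNReal.ofReal_toReal ((ξ x).apply_ne_top z)]
    unfold weightedNorm
    rw [ENNReal.tsum_mul_left, ENNReal.tsum_comm]
    simp_rw [ENNReal.tsum_mul_left, h1, mul_one]
    rw [tsum_subtype μ.support μ, ← PMF.toOuterMeasure_apply,
      (PMF.toOuterMeasure_apply_eq_one_iff μ _).2 subset_rfl, mul_one]
  have hlt : ∑' z, variation μ R (φ z) < ∑' z, ENNReal.ofReal ε * weightedNorm μ (φ z) := by
    rw [hnorm]
    refine hvar.trans_lt ((ENNReal.ofReal_lt_ofReal_iff hε).2 ?_)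
    rw [mul_div_assoc', div_lt_iff₀ (by positivity)]
    linarith
  obtain ⟨z, hz⟩ : ∃ z, variation μ R (φ z) < ENNReal.ofReal ε * weightedNorm μ (φ z) := by
    by_contra! hcon
    exact hlt.not_ge (ENNReal.tsum_le_tsum hcon)
  refine exists_set_of_function hX μ hR.le hε.le (by positivity) ?_ hz
  -- With `z` fixed, `ξ_x(z) ≠ 0` forces `x` into the ball about `z`, so the diameter is at most
  -- `2S`.
  have hball : ∀ x ∈ Function.support (φ z), dist z x ≤ S := fun x hx => by
    refine hsupp x ((ξ x).mem_support_iff z |>.2 fun h0 => hx ?_)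
    simp [φ, h0]
  rw [diamLE_iff (by positivity)]
  intro x hx y hy
  have := dist_triangle_left x y z
  linarith [hball x hx, hball y hy]

end Variation

/-! ### The weighted Hilbert space and operators of finite propagation -/

section WeightedL2

variable {X : Type u} {μ : PMF X} {H : Type v} [NormedAddCommGroup H]

theorem discreteMeasure_apply (μ : PMF X) (A : Set X) :
    discreteMeasure μ A = μ.toOuterMeasure A :=
  letI : MeasurableSpace X := ⊤
  μ.toMeasure_apply_eq_toOuterMeasure_apply trivial

theorem discreteMeasure_singleton (μ : PMF X) (x : X) : discreteMeasure μ {x} = μ x := by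
  rw [discreteMeasure_apply, PMF.toOuterMeasure_apply_singleton]

/-- Points of the support are atoms, so classes in `Lp` have genuine values there. -/
theorem eq_of_ae_eq {V : Type*} {f g : X → V} (h : f =ᵐ[discreteMeasure μ] g) {x : X}
    (hx : x ∈ μ.support) : f x = g x := by
  have h' := ae_iff.1 h
  rw [discreteMeasure_apply, PMF.toOuterMeasure_apply_eq_zero_iff] at h'
  by_contra hne
  exact Set.disjoint_left.1 h' hx hne

theorem ae_discreteMeasure {p : X → Prop} (h : ∀ x ∈ μ.support, p x) :
    ∀ᵐ x ∂(discreteMeasure μ), p x := by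
  rw [ae_iff, discreteMeasure_apply, PMF.toOuterMeasure_apply_eq_zero_iff]
  exact Set.disjoint_left.2 fun x hx hx' => hx' (h x hx)

theorem lintegral_discreteMeasure (μ : PMF X) (f : X → ℝ≥0∞) :
    ∫⁻ x, f x ∂(discreteMeasure μ) = ∑' x, μ x * f x := by
  let m : MeasurableSpace X := ⊤
  have : DiscreteMeasurableSpace X := ⟨fun _ => trivial⟩
  have hr : (discreteMeasure μ).restrict μ.support = discreteMeasure μ :=
    μ.restrict_toMeasure_support
  rw [← hr, lintegral_countable f μ.support_countable]
  simp_rw [discreteMeasure_singleton]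
  rw [tsum_subtype μ.support fun x => f x * μ x]
  refine tsum_congr fun x => ?_
  by_cases hx : x ∈ μ.support
  · rw [Set.indicator_of_mem hx, mul_comm]
  · rw [Set.indicator_of_notMem hx, (μ.apply_eq_zero_iff x).2 hx, zero_mul]

theorem enorm_sq_eq_tsum (φ : WeightedL2 μ H) :
    ‖φ‖ₑ ^ 2 = ∑' x, μ x * ‖(φ : X → H) x‖ₑ ^ 2 := by
  rw [Lp.enorm_def, ← lintegral_discreteMeasure]
  have := eLpNorm_nnreal_pow_eq_lintegral (μ := discreteMeasure μ) (f := (φ : X → H))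
    (p := 2) two_ne_zero
  simpa using this

/-- The restriction of an element of `ℓ²(X, μ, H)` to a subset. -/
noncomputable def restrictTo (φ : WeightedL2 μ H) (A : Set X) : WeightedL2 μ H :=
  ((Lp.memLp φ).indicator (s := A) MeasurableSpace.measurableSet_top).toLp

theorem restrictTo_apply (φ : WeightedL2 μ H) (A : Set X) {x : X} (hx : x ∈ μ.support) :
    (restrictTo φ A : X → H) x = A.indicator (φ : X → H) x :=
  eq_of_ae_eq (MemLp.coeFn_toLp _) hx

theorem enorm_restrictTo_sq (φ : WeightedL2 μ H) (A : Set X) :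
    ‖restrictTo φ A‖ₑ ^ 2 = ∑' x, A.indicator (fun x => μ x * ‖(φ : X → H) x‖ₑ ^ 2) x := by
  rw [enorm_sq_eq_tsum]
  refine tsum_congr fun x => ?_
  by_cases hx : x ∈ μ.support
  · rw [restrictTo_apply φ A hx]
    by_cases hA : x ∈ A <;> simp [hA]
  · have : μ x = 0 := (μ.apply_eq_zero_iff x).2 hx
    simp [Set.indicator, this]

theorem l2Support_restrictTo_subset (φ : WeightedL2 μ H) (A : Set X) :
    l2Support (restrictTo φ A) ⊆ A := by
  rintro x ⟨hx, hne⟩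
  rw [restrictTo_apply φ A hx] at hne
  exact Set.mem_of_indicator_ne_zero hne

theorem pointFunction_apply (y : X) (h : H) {x : X} (hx : x ∈ μ.support) :
    (pointFunction μ y h : X → H) x = ({y} : Set X).indicator (fun _ => h) x :=
  eq_of_ae_eq indicatorConstLp_coeFn hx

variable [InnerProductSpace ℂ H]

theorem l2Support_smul_subset (a : ℂ) (φ : WeightedL2 μ H) :
    l2Support (a • φ) ⊆ l2Support φ := by
  rintro x ⟨hx, hne⟩
  refine ⟨hx, fun h0 => hne ?_⟩
  rw [eq_of_ae_eq (Lp.coeFn_smul a φ) hx, Pi.smul_apply, h0, smul_zero]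

theorem exists_unit_vector [MetricSpace X] {T : WeightedL2 μ H →L[ℂ] WeightedL2 μ H}
    {φ : WeightedL2 μ H} (hφ : φ ≠ 0) {S c : ℝ} (hd : DiamLE (l2Support φ) S) (h : c * ‖T‖ * ‖φ‖ ≤ ‖T φ‖) :
    ∃ ψ : WeightedL2 μ H, ‖ψ‖ = 1 ∧ DiamLE (l2Support ψ) S ∧ c * ‖T‖ ≤ ‖T ψ‖ := by
  have hpos : 0 < ‖φ‖ := norm_pos_iff.2 hφ
  refine ⟨((‖φ‖⁻¹ : ℝ) : ℂ) • φ, ?_, hd.mono (l2Support_smul_subset _ _), ?_⟩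
  · rw [norm_smul, Complex.norm_real, norm_inv, norm_norm, inv_mul_cancel₀ hpos.ne']
  · rw [map_smul, norm_smul, Complex.norm_real, norm_inv, norm_norm, ← div_eq_inv_mul,
      le_div_iff₀ hpos]
    exact h

variable [CompleteSpace H]

theorem inner_pointFunction (x : X) (h : H) (f : WeightedL2 μ H) :
    inner ℂ (pointFunction μ x h) f = ((μ x).toReal : ℂ) * inner ℂ h ((f : X → H) x) := by
  let m : MeasurableSpace X := ⊤
  have : DiscreteMeasurableSpace X := ⟨fun _ => trivial⟩
  refine (L2.inner_indicatorConstLp_eq_inner_setIntegral ℂ (μ := discreteMeasure μ)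
    (MeasurableSet.of_discrete (s := {x})) (measure_ne_top _ _) h f).trans ?_
  rw [integral_singleton, Measure.real, discreteMeasure_singleton, ← Complex.coe_smul,
    inner_smul_right]

variable [MetricSpace X]

/-- Passes from point functions to arbitrary `ψ` by duality: the adjoint sends a point function at
`x` to a vector vanishing at support points farther than `R` from `x`, so its inner product with `ψ`
is zero. -/
theorem PropagationLE.apply_eq_zero {T : WeightedL2 μ H →L[ℂ] WeightedL2 μ H} {R : ℝ}
    (hT : PropagationLE T R) {x : X} (hx : x ∈ μ.support) {ψ : WeightedL2 μ H}
    (hψ : ∀ y ∈ μ.support, dist x y ≤ R → (ψ : X → H) y = 0) : (T ψ : X → H) x = 0 := by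
  have hμ : ∀ {y}, y ∈ μ.support → ((μ y).toReal : ℂ) ≠ 0 := fun {y} hy =>
    Complex.ofReal_ne_zero.2 (ENNReal.toReal_pos hy (μ.apply_ne_top y)).ne'
  refine ext_inner_left ℂ fun h => ?_
  rw [inner_zero_right]
  have hadj : ∀ y ∈ μ.support, R < dist x y →
      (ContinuousLinearMap.adjoint T (pointFunction μ x h) : X → H) y = 0 := by
    intro y hy hxy
    refine ext_inner_left ℂ fun k => ?_
    rw [inner_zero_right]
    refine (mul_eq_zero.1 ?_).resolve_left (hμ hy)
    rw [← inner_pointFunction, ContinuousLinearMap.adjoint_inner_right, ← inner_conj_symm,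
      inner_pointFunction, hT x hx y hy hxy]
    simp
  refine (mul_eq_zero.1 ?_).resolve_left (hμ hx)
  rw [← inner_pointFunction, ← ContinuousLinearMap.adjoint_inner_left, L2.inner_def]
  refine integral_eq_zero_of_ae (ae_discreteMeasure fun y hy => ?_)
  rcases le_or_gt (dist x y) R with hxy | hxy
  · simp [hψ y hy hxy]
  · simp [hadj y hy hxy]

theorem PropagationLE.apply_restrictTo {T : WeightedL2 μ H →L[ℂ] WeightedL2 μ H} {R : ℝ}
    (hT : PropagationLE T R) (φ : WeightedL2 μ H) {A : Set X} {x : X} (hx : x ∈ μ.support)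
    (hxA : x ∈ A) : (T (restrictTo φ (nbhd R A)) : X → H) x = (T φ : X → H) x := by
  have h0 : (T (φ - restrictTo φ (nbhd R A)) : X → H) x = 0 := by
    refine hT.apply_eq_zero hx fun y hy hxy => ?_
    rw [eq_of_ae_eq (Lp.coeFn_sub _ _) hy, Pi.sub_apply, restrictTo_apply φ _ hy,
      Set.indicator_of_mem (show y ∈ nbhd R A from ⟨x, hxA, by rwa [dist_comm]⟩), sub_self]
  rw [map_sub, eq_of_ae_eq (Lp.coeFn_sub _ _) hx, Pi.sub_apply, sub_eq_zero] at h0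
  exact h0.symm

theorem exists_localised_vector {T : WeightedL2 μ H →L[ℂ] WeightedL2 μ H} {R c : ℝ}
    (hR : 0 ≤ R) (hc : 0 < c) (hT : PropagationLE T R) (hT0 : T ≠ 0) {S : ℝ}
    (hmsp : ∀ ν : PMF X, ∃ (Ω : Set X) (P : Set (Set X)), Ω = ⋃₀ P ∧ c ≤ mass ν Ω ∧
      (∀ A ∈ P, DiamLE A S) ∧
      (∀ A ∈ P, ∀ B ∈ P, A ≠ B → ENNReal.ofReal (2 * R) < setDist A B)) :
    ∃ (φ : WeightedL2 μ H) (A : Set X), DiamLE A S ∧ l2Support φ ⊆ nbhd R A ∧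
      √c / 2 * ‖T‖ * ‖φ‖ < ‖T φ‖ := by
  have hTpos : 0 < ‖T‖ := norm_pos_iff.2 hT0
  obtain ⟨φ, hφ1, hφT⟩ := T.exists_lt_apply_of_lt_opNorm (half_lt_self hTpos)
  have hTφ : 0 < ‖T φ‖ := (half_pos hTpos).trans hφT
  let f : X → ℝ≥0∞ := fun x => μ x * ‖(T φ : X → H) x‖ₑ ^ 2
  have hf : ∑' x, f x = ENNReal.ofReal (‖T φ‖ ^ 2) := by
    rw [← enorm_sq_eq_tsum, ENNReal.ofReal_pow (norm_nonneg _), ofReal_norm]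
  have hf0 : tsum f ≠ 0 := by
    rw [hf, Ne, ENNReal.ofReal_eq_zero, not_le]
    positivity
  have hftop : tsum f ≠ ∞ := by
    rw [hf]
    exact ENNReal.ofReal_ne_top
  -- Sparsification applies to the distribution of `‖Tφ‖²`, not to `μ`; separation `2R` makes the
  -- `R`-neighbourhoods of the pieces disjoint.
  obtain ⟨Ω, P, rfl, hΩ, hdiam, hsep⟩ := hmsp (PMF.normalize f hf0 hftop)
  have hΩ' : ENNReal.ofReal (c * ‖T φ‖ ^ 2) ≤ ∑' x, (⋃₀ P).indicator f x := by
    have h1 := ENNReal.ofReal_le_ofReal hΩ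
    have h2 : (PMF.normalize f hf0 hftop).toOuterMeasure (⋃₀ P)
        = (∑' x, (⋃₀ P).indicator f x) * (∑' x, f x)⁻¹ := by
      rw [PMF.toOuterMeasure_apply, ← ENNReal.tsum_mul_right]
      refine tsum_congr fun x => ?_
      by_cases hx : x ∈ ⋃₀ P
      · simp only [Set.indicator_of_mem hx, PMF.normalize_apply]
      · simp only [Set.indicator_of_notMem hx, zero_mul]
    rw [ofReal_mass, h2, ← div_eq_mul_inv, ENNReal.le_div_iff_mul_le (Or.inl hf0)
      (Or.inl hftop), hf, ← ENNReal.ofReal_mul hc.le] at h1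
    exact h1
  by_contra! hcon
  have hpiece : ∀ A : P, ∑' x, (A : Set X).indicator f x ≤
      ENNReal.ofReal ((√c / 2 * ‖T‖) ^ 2) *
        ∑' x, (nbhd R (A : Set X)).indicator (fun x => μ x * ‖(φ : X → H) x‖ₑ ^ 2) x := by
    intro A
    rw [← enorm_restrictTo_sq φ]
    have h1 := hcon (restrictTo φ (nbhd R (A : Set X))) A (hdiam A A.2)
      (l2Support_restrictTo_subset _ _)
    calc ∑' x, (A : Set X).indicator f x
        ≤ ‖T (restrictTo φ (nbhd R (A : Set X)))‖ₑ ^ 2 := by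
          rw [enorm_sq_eq_tsum]
          refine ENNReal.tsum_le_tsum fun x => ?_
          by_cases hxA : x ∈ (A : Set X)
          · rw [Set.indicator_of_mem hxA]
            by_cases hx : x ∈ μ.support
            · rw [hT.apply_restrictTo φ hx hxA]
            · simp [f, (μ.apply_eq_zero_iff x).2 hx]
          · rw [Set.indicator_of_notMem hxA]
            exact zero_le
      _ ≤ _ := by
          rw [← ofReal_norm, ← ofReal_norm, ← ENNReal.ofReal_pow (norm_nonneg _),
            ← ENNReal.ofReal_pow (norm_nonneg _), ← ENNReal.ofReal_mul (by positivity),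
            ← mul_pow]
          exact ENNReal.ofReal_le_ofReal (pow_le_pow_left₀ (norm_nonneg _) h1 2)
  -- Summing over the pieces gives `‖Tφ‖ ≤ ‖T‖ / 2`, against the choice of `φ`.
  have htotal : ENNReal.ofReal (c * ‖T φ‖ ^ 2) ≤ ENNReal.ofReal ((√c / 2 * ‖T‖) ^ 2) := by
    calc ENNReal.ofReal (c * ‖T φ‖ ^ 2) ≤ ∑' A : P, ∑' x, (A : Set X).indicator f x := by
          rwa [tsum_indicator_sUnion (pairwiseDisjoint_of_setDist (by positivity) hsep)]
      _ ≤ ENNReal.ofReal ((√c / 2 * ‖T‖) ^ 2) * ‖φ‖ₑ ^ 2 := by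
          refine (ENNReal.tsum_le_tsum hpiece).trans ?_
          rw [ENNReal.tsum_mul_left, enorm_sq_eq_tsum]
          gcongr
          exact tsum_indicator_le_of_disjoint (eq_of_mem_nbhd le_rfl hsep) _
      _ ≤ ENNReal.ofReal ((√c / 2 * ‖T‖) ^ 2) * 1 := by
          gcongr
          refine pow_le_one₀ zero_le ?_
          rw [← ofReal_norm]
          exact ENNReal.ofReal_le_one.2 hφ1.le
      _ = _ := mul_one _
  rw [ENNReal.ofReal_le_ofReal_iff (by positivity), mul_pow, div_pow, Real.sq_sqrt hc.le] at htotal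
  have : (‖T‖ / 2) ^ 2 < ‖T φ‖ ^ 2 := pow_lt_pow_left₀ hφT (by positivity) two_ne_zero
  have := mul_lt_mul_of_pos_left this hc
  linarith

end WeightedL2

theorem ONL_of_MSP {X : Type u} [MetricSpace X] (h : MSP X) : ONL.{u, v} X := by
  obtain ⟨c, hc, h⟩ := h
  refine ⟨√c / 2, by positivity, fun R hR => ?_⟩
  obtain ⟨S, hS, h⟩ := h (2 * R) (by positivity)
  refine ⟨S + 2 * R, by positivity, fun μ H _ _ _ _ _ T hT => ?_⟩
  -- For `T = 0` any unit vector supported at one atom works; this needs `H` nonzero.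
  by_cases hT0 : T = 0
  · obtain ⟨y, hy⟩ := μ.support_nonempty
    obtain ⟨k, hk⟩ := exists_ne (0 : H)
    have hne : pointFunction μ y k ≠ 0 := by
      intro h0
      have h1 := pointFunction_apply y k hy
      rw [h0, eq_of_ae_eq (Lp.coeFn_zero H 2 _) hy] at h1
      simp at h1
      exact hk h1.symm
    refine exists_unit_vector hne ?_ (by simp [hT0])
    refine DiamLE.mono (E := {y}) (by simp [DiamLE]) ?_
    rintro x ⟨hx, hxne⟩
    rw [pointFunction_apply y k hx] at hxne
    exact Set.mem_of_indicator_ne_zero hxne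
  · obtain ⟨φ, A, hA, hsupp, hlt⟩ := exists_localised_vector hR.le hc hT hT0 h
    refine exists_unit_vector ?_ ((hA.nbhd hS.le hR.le).mono hsupp) hlt.le
    rintro rfl
    simp at hlt

/-! ### Amenable groups have property A -/

section Amenable

variable {G : Type w} [Group G] [MetricSpace G] [IsIsometricSMul G G]

theorem boundedGeometry_of_properGroupMetric (hG : ProperGroupMetric G) : BoundedGeometry G := by
  intro R _
  refine ⟨(Metric.closedBall (1 : G) R).ncard, fun x => ?_⟩
  have hx : Metric.closedBall x R = x • Metric.closedBall (1 : G) R := by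
    rw [Metric.smul_closedBall, smul_eq_mul, mul_one]
  rw [hx, Set.encard_smul_set, (hG 1 R).cast_ncard_eq]

theorem tsum_abs_uniformOfFinset_sub {α : Type*} {A B : Finset α} (hA : A.Nonempty)
    (hB : B.Nonempty) (hcard : A.card = B.card) :
    ∑' z, |(PMF.uniformOfFinset A hA z).toReal - (PMF.uniformOfFinset B hB z).toReal|
      = ((A : Set α) ∆ (B : Set α)).ncard / (A.card : ℝ) := by
  classical
  rw [← Finset.coe_symmDiff, Set.ncard_coe_finset, tsum_eq_sum (s := A ∆ B), div_eq_mul_inv,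
    ← nsmul_eq_mul, ← Finset.sum_const]
  · refine Finset.sum_congr rfl fun z hz => ?_
    rcases Finset.mem_symmDiff.1 hz with h | h
    · simp [PMF.uniformOfFinset_apply, h.1, h.2]
    · simp [PMF.uniformOfFinset_apply, h.1, h.2, hcard]
  · intro z hz
    have hiff : z ∈ A ↔ z ∈ B := by
      simp only [Finset.mem_symmDiff] at hz
      tauto
    by_cases h : z ∈ B <;> simp [PMF.uniformOfFinset_apply, hiff, h, hcard]

/-- Take `ξ_g` uniform on `g • F`, which stays near `g` by left invariance. Comparing `x • F` with
`y • F` amounts to comparing `F` with its translate by `x⁻¹ * y`, which lies in the finite ball of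
radius `R` about `1`. -/
theorem propertyA_of_amenableGroup (hG : ProperGroupMetric G) (h : AmenableGroup G) :
    PropertyA G := by
  classical
  intro R _ ε hε
  obtain ⟨F, hF, hFol⟩ := h (hG 1 R).toFinset (ε / 2) (by positivity)
  obtain ⟨S, hS⟩ := (F.image fun f => dist f (1 : G)).bddAbove
  refine ⟨max S 1, by positivity, fun g => PMF.uniformOfFinset (g • F) hF.smul_finset, ?_, ?_⟩
  · intro x y hxy
    rw [tsum_abs_uniformOfFinset_sub _ _ (by simp), Finset.card_smul_finset,
      Finset.coe_smul_finset, Finset.coe_smul_finset]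
    have hcard : (0 : ℝ) < F.card := by exact_mod_cast hF.card_pos
    have hk : x⁻¹ * y ∈ (hG 1 R).toFinset := by
      rw [Set.Finite.mem_toFinset, Metric.mem_closedBall, ← dist_smul x]
      simpa [dist_comm] using hxy
    have h1 := hFol _ hk
    have h2 : (x • (F : Set G)) ∆ (y • (F : Set G))
        = x • (((x⁻¹ * y) • (F : Set G)) ∆ (F : Set G)) := by
      rw [Set.smul_set_symmDiff, smul_smul, mul_inv_cancel_left, symmDiff_comm]
    rw [h2, Set.ncard_smul_set, div_lt_iff₀ hcard]
    nlinarith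
  · intro g z hz
    rw [PMF.support_uniformOfFinset, Finset.coe_smul_finset] at hz
    obtain ⟨f, hf, rfl⟩ := hz
    have h1 : dist f 1 ≤ S := hS (Finset.mem_coe.2 (Finset.mem_image_of_mem _ hf))
    have h2 : dist (g • f) g = dist f 1 := by
      simpa using dist_smul g f 1
    simp only [Metric.mem_closedBall, h2]
    exact h1.trans (le_max_left _ _)

end Amenable

end CoarseGeometry

theorem mainTheorem1 :
    (∀ (X : Type u) [MetricSpace X], CoarseGeometry.BoundedGeometry X →
      (CoarseGeometry.PropertyA X → CoarseGeometry.ULAmu X) ∧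
      (CoarseGeometry.ULAmu X ↔ CoarseGeometry.ULAmuFun X) ∧
      (CoarseGeometry.ULAmu X ↔ CoarseGeometry.MSP X) ∧
      (CoarseGeometry.MSP X → CoarseGeometry.ONL.{u, v} X) ∧
      (CoarseGeometry.PropertyA X → CoarseGeometry.ONL.{u, v} X)) ∧
    (∀ (G : Type w) [Group G] [MetricSpace G] [IsIsometricSMul G G],
      CoarseGeometry.ProperGroupMetric G → CoarseGeometry.AmenableGroup G →
      CoarseGeometry.MSP G ∧ CoarseGeometry.ONL.{w, v} G) := by
  refine ⟨fun X _ hX => ⟨CoarseGeometry.ULAmu_of_propertyA hX,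
    ⟨CoarseGeometry.ULAmuFun_of_ULAmu hX, CoarseGeometry.ULAmu_of_ULAmuFun hX⟩,
    ⟨CoarseGeometry.MSP_of_ULAmu, CoarseGeometry.ULAmu_of_MSP hX⟩,
    CoarseGeometry.ONL_of_MSP, fun h => CoarseGeometry.ONL_of_MSP
      (CoarseGeometry.MSP_of_ULAmu (CoarseGeometry.ULAmu_of_propertyA hX h))⟩, ?_⟩
  intro G _ _ _ hG hA
  have hmsp : CoarseGeometry.MSP G := CoarseGeometry.MSP_of_ULAmu
    (CoarseGeometry.ULAmu_of_propertyA (CoarseGeometry.boundedGeometry_of_properGroupMetric hG)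
      (CoarseGeometry.propertyA_of_amenableGroup hG hA))
  exact ⟨hmsp, CoarseGeometry.ONL_of_MSP hmsp⟩
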